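/- Let $X$ and $Y$ be finite-dimensional real Hilbert spaces (for instance $X=\mathbb R^n$, $Y=\mathbb R^m$). Let $f:X\to\mathbb R$ be continuously differentiable and convex, let $g:Y\to\mathbb R\cup\{+\infty\}$ be proper, lower semicontinuous and convex, and put $\operatorname{hzn} g:=\{v\in Y\mid g(z+v)\le g(z)\ \ \forall z\in\operatorname{dom} g\}$. Let $c:X\to Y$ be continuously differentiable and such that $$c(\lambda x+(1-\lambda)x')-\lambda c(x)-(1-\lambda)c(x')\in\operatorname{hzn} g\qquad\text{for all } x,x'\in X,\ \lambda\in[0,1].$$ Consider the problem of minimizing $\Phi(x):=f(x)+g(c(x))$ over $X$. Assume that it is feasible and has a minimizer, and let $\Phi^*$ be its minimal value. A feasible point $\bar x$ is called stationary if there is $\bar y\in Y$ with $\nabla f(\bar x)+c'(\bar x)^\top\bar y=0$ and $c(\bar x)\in\partial g^*(\bar y)$, where $g^*$ is the conjugate of $g$. Assume that some minimizer is stationary. For $\mu>0$ let $$\mathcal L_\mu(x,y):=f(x)+\inf_{z\in Y}\Big\{g(z)+\langle y,c(x)-z\rangle+\tfrac1{2\mu}\|c(x)-z\|^2\Big\}.$$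 Let $Y_{\rm sg}\subseteq Y$ be nonempty, convex and compact, $\beta\in(0,1)$, $y^0\in Y$, $\mu_0>0$, and let the sequences satisfy, for every $k=0,1,2,\dots$, with some $\varepsilon_k\ge 0$, $$\hat y^k=\Pi_{Y_{\rm sg}}(y^k),\qquad \mathcal L_{\mu_k}(x^k,\hat y^k)\le\inf_{x\in X}\mathcal L_{\mu_k}(x,\hat y^k)+\varepsilon_k,$$ $$z^k=\operatorname{prox}_{\mu_k g}\big(c(x^k)+\mu_k\hat y^k\big),\qquad y^{k+1}=\hat y^k+\mu_k^{-1}\big(c(x^k)-z^k\big),$$ $$\mu_{k+1}=\beta_k\mu_k\quad\text{for some }\beta_k\in(0,\beta]\cup\{1\}.$$ Assume that the penalty parameter is updated as follows: there are $\beta',\theta\in(0,1)$ such that, for every $k\ge 0$, $\mu_{k+1}=\mu_k$ if $k=0$ or $\|c(x^k)-z^k\|\le\theta\|c(x^{k-1})-z^{k-1}\|$, and $\mu_{k+1}=\beta'\mu_k$ otherwise. Assume also that $$\sum_{k=0}^\infty\sqrt{\varepsilon_k/\mu_k}<\infty.$$ Then $c(x^k)-z^k\to 0$ and $$\limsup_{k\to\infty}\big(f(x^k)+g(z^k)\big)\le\Phi^*.$$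 Moreover, each accumulation point of $(x^k)$ is a minimizer of $\Phi$; and whenever a subsequence $(x^k)_{k\in K}$ converges to some $\bar x$, then $z^k\to_K c(\bar x)$ and $f(x^k)+g(z^k)\to_K\Phi^*$. -/

import Mathlib

open Filter Topology

namespace ConvexComposite

noncomputable section

/-- The domain of an extended-real-valued function. -/
def dom {Y : Type*} (φ : Y → EReal) : Set Y := {z | φ z < ⊤}

/-- The domain is a nonempty set on which the function is finite. -/
def IsProper {Y : Type*} (φ : Y → EReal) : Prop :=
  (dom φ).Nonempty ∧ ∀ z, φ z ≠ ⊥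

/-- Convexity of an extended-real-valued function: its epigraph is convex. -/
def IsConvex {Y : Type*} [AddCommMonoid Y] [Module ℝ Y] (φ : Y → EReal) : Prop :=
  Convex ℝ {p : Y × ℝ | φ p.1 ≤ (p.2 : EReal)}

/-- The horizon `hzn φ = {v | ∀ z ∈ dom φ, φ (z + v) ≤ φ z}`. -/
def horizon {Y : Type*} [Add Y] (φ : Y → EReal) : Set Y :=
  {v | ∀ z ∈ dom φ, φ (z + v) ≤ φ z}

section

variable {X Y : Type*} [NormedAddCommGroup X] [InnerProductSpace ℝ X]
  [NormedAddCommGroup Y] [InnerProductSpace ℝ Y]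

/-- The subdifferential of `φ` at `z₀`; it is empty unless `φ z₀` is finite. -/
def subdifferential (φ : Y → EReal) (z₀ : Y) : Set Y :=
  {y | φ z₀ ≠ ⊥ ∧ φ z₀ ≠ ⊤ ∧
    ∀ z ∈ dom φ, φ z₀ + ((inner ℝ y (z - z₀) : ℝ) : EReal) ≤ φ z}

/-- The conjugate `φ* y = sup_z (⟨z, y⟩ - φ z)`. -/
def conjugate (φ : Y → EReal) (y : Y) : EReal :=
  ⨆ z : Y, (((inner ℝ z y : ℝ) : EReal) - φ z)

/-- The Moreau envelope `φ^γ v = inf_w (φ w + ‖w - v‖² / (2γ))`. -/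
def moreauEnvelope (φ : Y → EReal) (γ : ℝ) (v : Y) : EReal :=
  ⨅ w : Y, (φ w + ((1 / (2 * γ) * ‖w - v‖ ^ 2 : ℝ) : EReal))

/-- `w = prox_{γ φ}(v)`: the infimum that defines the Moreau envelope is attained at `w`. -/
def IsProx (φ : Y → EReal) (γ : ℝ) (v w : Y) : Prop :=
  φ w + ((1 / (2 * γ) * ‖w - v‖ ^ 2 : ℝ) : EReal) = moreauEnvelope φ γ v

/-- `p = Π_C(y)`: the point `p` of `C` realises the distance of `y` to `C`. -/
def IsProjection (C : Set Y) (y p : Y) : Prop :=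
  p ∈ C ∧ ‖p - y‖ = Metric.infDist y C

/-- The objective `Φ x = f x + g (c x)`. -/
def objective (f : X → ℝ) (g : Y → EReal) (c : X → Y) (x : X) : EReal :=
  (f x : EReal) + g (c x)

/-- The infimal value `Φ*` of the composite problem. -/
def optimalValue (f : X → ℝ) (g : Y → EReal) (c : X → Y) : EReal :=
  ⨅ x : X, objective f g c x

/-- `x₀` is a (global, feasible) minimizer of the composite problem. -/
def IsMinimizer (f : X → ℝ) (g : Y → EReal) (c : X → Y) (x₀ : X) : Prop :=
  c x₀ ∈ dom g ∧ ∀ x, objective f g c x₀ ≤ objective f g c x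

/-- Stationarity of a feasible point `x₀`: for some `y₀`, the Lagrangian
`L(x, y) = f x + ⟨y, c x⟩ - g* y` satisfies `∇ₓ L(x₀, y₀) = 0` (the term `g* y₀` does not depend
on `x`), and `c x₀ ∈ ∂g*(y₀)`, that is `0 ∈ ∂_y(-L)(x₀, y₀)`. -/
def IsStationary (f : X → ℝ) (g : Y → EReal) (c : X → Y) (x₀ : X) : Prop :=
  c x₀ ∈ dom g ∧ ∃ y₀ : Y,
    HasFDerivAt (fun x => f x + inner ℝ y₀ (c x)) (0 : X →L[ℝ] ℝ) x₀ ∧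
    c x₀ ∈ subdifferential (conjugate g) y₀

/-- The augmented Lagrangian
`L_μ(x, y) = f x + inf_z (g z + ⟨y, c x - z⟩ + ‖c x - z‖² / (2μ))`. -/
def augLagrangian (f : X → ℝ) (g : Y → EReal) (c : X → Y) (μ : ℝ) (x : X) (y : Y) : EReal :=
  (f x : EReal) + ⨅ z : Y,
    (g z + ((inner ℝ y (c x - z) + 1 / (2 * μ) * ‖c x - z‖ ^ 2 : ℝ) : EReal))

/-- The standing assumptions on a fully convex composite problem. -/
structure IsFullyConvex (f : X → ℝ) (g : Y → EReal) (c : X → Y) : Prop where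
  f_contDiff : ContDiff ℝ 1 f
  f_convex : ConvexOn ℝ Set.univ f
  g_proper : IsProper g
  g_lsc : LowerSemicontinuous g
  g_convex : IsConvex g
  c_contDiff : ContDiff ℝ 1 c
  c_convex : ∀ x x' : X, ∀ t ∈ Set.Icc (0 : ℝ) 1,
    c (t • x + (1 - t) • x') - t • c x - (1 - t) • c x' ∈ horizon g
  exists_minimizer : ∃ x₀, IsMinimizer f g c x₀

/-- The sequences `x, z, y, yhat` (with tolerances `ε` and penalty parameters `μ`) are generated by
the safeguarded augmented Lagrangian method with safeguarding set `Ysg` and parameter `β`. -/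
structure IsSafeguardedALM (f : X → ℝ) (g : Y → EReal) (c : X → Y) (Ysg : Set Y) (β : ℝ)
    (ε μ : ℕ → ℝ) (x : ℕ → X) (z y yhat : ℕ → Y) : Prop where
  safeguard_nonempty : Ysg.Nonempty
  safeguard_convex : Convex ℝ Ysg
  safeguard_compact : IsCompact Ysg
  β_mem : β ∈ Set.Ioo (0 : ℝ) 1
  μ_zero_pos : 0 < μ 0
  yhat_eq : ∀ k, IsProjection Ysg (y k) (yhat k)
  ε_nonneg : ∀ k, 0 ≤ ε k
  x_approx : ∀ k, augLagrangian f g c (μ k) (x k) (yhat k) ≤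
    (⨅ x' : X, augLagrangian f g c (μ k) x' (yhat k)) + (ε k : EReal)
  z_eq : ∀ k, IsProx g (μ k) (c (x k) + μ k • yhat k) (z k)
  y_succ : ∀ k, y (k + 1) = yhat k + (μ k)⁻¹ • (c (x k) - z k)
  μ_succ : ∀ k, ∃ b ∈ Set.Ioc (0 : ℝ) β ∪ {1}, μ (k + 1) = b * μ k

/-- The adaptive penalty update: `μ` is kept if `k = 0` or if the constraint violation
`‖c (x k) - z k‖` was reduced by the factor `θ`, and multiplied by `β` otherwise. -/
def AdaptivePenaltyUpdate (c : X → Y) (β θ : ℝ) (μ : ℕ → ℝ) (x : ℕ → X) (z : ℕ → Y) : Prop :=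
  ∀ k : ℕ, μ (k + 1) =
    if k = 0 ∨ ‖c (x k) - z k‖ ≤ θ * ‖c (x (k - 1)) - z (k - 1)‖ then μ k else β * μ k

end

end

end ConvexComposite

namespace ConvexComposite

/-! ### Convex duality and the augmented Lagrangian -/

section ExtendedReal

variable {X Y : Type*} [NormedAddCommGroup X] [InnerProductSpace ℝ X]
  [NormedAddCommGroup Y] [InnerProductSpace ℝ Y]

/-! Write `r k = c (x k) - z k`. A multiplier `y₀` at the stationary minimizer gives, by convexity,
`Φ* ≤ f (x k) + g (z k) + ⟨y₀, r k⟩` (`IsFullyConvex.exists_multiplier`). Approximate minimality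
gives `f (x k) + g (z k) + ⟨yhat k, r k⟩ + ‖r k‖² / (2 μ k) ≤ Φ* + ε k`. As `yhat` is bounded,
subtracting leaves `‖r k‖² / (2 μ k) ≤ ε k + M ‖r k‖`; since `ε k / μ k` is bounded, `‖r k‖ = O(μ
k)` (`residual_le_mul`). The update rule then forces `r k → 0`: either the residual eventually
contracts geometrically, or `μ k → 0` (`tendsto_residual_of_adaptive_update`). The two inequalities
now squeeze the values to `Φ*`, and closedness of the epigraph of `g` handles accumulation points.
-/

lemma IsProper.exists_coe_eq {Y : Type*} {g : Y → EReal} (hg : IsProper g) {z : Y} (hz : g z ≠ ⊤) :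
    ∃ a : ℝ, g z = a :=
  ⟨(g z).toReal, (EReal.coe_toReal hz (hg.2 z)).symm⟩

/-- The real epigraph of a lower semicontinuous extended-real-valued function is closed. -/
lemma isClosed_epigraph_real {Y : Type*} [TopologicalSpace Y] {g : Y → EReal} (hg : LowerSemicontinuous g) :
    IsClosed {p : Y × ℝ | g p.1 ≤ (p.2 : EReal)} := by
  have hcont : Continuous fun p : Y × ℝ => ((p.1, (p.2 : EReal)) : Y × EReal) :=
    continuous_fst.prodMk (continuous_coe_real_ereal.comp continuous_snd)
  exact hg.isClosed_epigraph.preimage hcont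

/-- A closed convex function has, at each point of its domain, affine minorants whose value there
is arbitrarily close to that of the function. -/
lemma exists_affine_minorant [CompleteSpace Y] {g : Y → EReal} (hlsc : LowerSemicontinuous g)
    (hconv : IsConvex g) {u : Y} {a : ℝ} (hu : g u = a) {δ : ℝ} (hδ : 0 < δ) :
    ∃ w : Y, ∀ (z : Y) (b : ℝ), g z ≤ b → a - δ + inner ℝ w (z - u) ≤ b := by
  have hnot : (u, a - δ) ∉ {p : Y × ℝ | g p.1 ≤ (p.2 : EReal)} := by
    simp only [Set.mem_ofPred_eq, hu, EReal.coe_le_coe_iff]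
    linarith
  obtain ⟨φ, s, hs, hE⟩ :=
    geometric_hahn_banach_point_closed hconv (isClosed_epigraph_real hlsc) hnot
  have hdecomp : ∀ (z : Y) (b : ℝ), φ (z, b) = φ (z, 0) + b * φ (0, 1) := by
    intro z b
    rw [← smul_eq_mul, ← map_smul, ← map_add]
    simp
  set τ := φ (0, 1) with hτ
  set ℓ : Y →L[ℝ] ℝ := φ.comp (ContinuousLinearMap.inl ℝ Y ℝ) with hℓ
  have hℓ' : ∀ z, φ (z, 0) = ℓ z := fun z => by simp [hℓ]
  have h1 := hE (u, a) (by simp [hu])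
  rw [hdecomp] at h1 hs
  -- The separated points `(u, a - δ)` and `(u, a)` lie on one vertical line, so the hyperplane is
  -- not vertical.
  have hτpos : 0 < τ := by
    by_contra! h
    nlinarith
  refine ⟨-(τ⁻¹ • (InnerProductSpace.toDual ℝ Y).symm ℓ), fun z b hz => ?_⟩
  have h2 := hE (z, b) hz
  rw [hdecomp] at h2
  rw [inner_neg_left, real_inner_smul_left, InnerProductSpace.toDual_symm_apply, map_sub,
    ← hℓ', ← hℓ']
  have h3 : (a - δ - b) * τ < φ (z, 0) - φ (u, 0) := by linarith
  have h4 : a - δ - b < τ⁻¹ * (φ (z, 0) - φ (u, 0)) := by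
    rw [inv_mul_eq_div, lt_div_iff₀ hτpos]
    exact h3
  linarith

/-- If `u ∈ ∂g*(y)` and `g` is closed, proper and convex, then `y ∈ ∂g(u)`. -/
lemma subgradient_of_mem_subdifferential_conjugate [CompleteSpace Y] {g : Y → EReal}
    (hlsc : LowerSemicontinuous g) (hconv : IsConvex g) {u y : Y} {a : ℝ} (hu : g u = a)
    (h : u ∈ subdifferential (conjugate g) y) (z : Y) (b : ℝ) (hz : g z = b) :
    a + inner ℝ y (z - u) ≤ b := by
  obtain ⟨hbot, htop, hsub⟩ := h
  obtain ⟨s, hs⟩ : ∃ s : ℝ, conjugate g y = s := ⟨_, (EReal.coe_toReal htop hbot).symm⟩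
  have hzs : inner ℝ z y - b ≤ s := by
    have : ((inner ℝ z y : ℝ) : EReal) - g z ≤ conjugate g y :=
      le_iSup (fun z : Y => ((inner ℝ z y : ℝ) : EReal) - g z) z
    rw [hz, hs] at this
    exact_mod_cast this
  -- Equality in Fenchel–Young: an affine minorant of slope `w`, nearly tight at `u`, bounds `g* w`
  -- by `⟨u, w⟩ - a + δ`, and the subgradient inequality at `w` cancels `⟨u, w⟩`.
  have has : a ≤ inner ℝ u y - s := by
    refine le_of_forall_pos_le_add fun δ hδ => ?_
    obtain ⟨w, hw⟩ := exists_affine_minorant hlsc hconv hu hδ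
    have hle : conjugate g w ≤ ((inner ℝ u w - a + δ : ℝ) : EReal) := by
      refine iSup_le fun z' => ?_
      induction hz' : g z' with
      | bot =>
        have := hw z' (a - δ + inner ℝ w (z' - u) - 1) (by simp [hz'])
        linarith
      | top => simp
      | coe b' =>
        have := hw z' b' hz'.le
        rw [inner_sub_right, real_inner_comm, real_inner_comm u w] at this
        rw [← EReal.coe_sub, EReal.coe_le_coe_iff]
        linarith
    have := (hsub w (hle.trans_lt (EReal.coe_lt_top _))).trans hle
    rw [hs, ← EReal.coe_add, EReal.coe_le_coe_iff, inner_sub_right] at this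
    linarith
  rw [inner_sub_right, real_inner_comm, real_inner_comm u y]
  linarith

/-- A critical point of a convex function is a global minimizer. -/
lemma le_of_convexOn_of_hasFDerivAt_zero {ψ : X → ℝ} (hψ : ConvexOn ℝ Set.univ ψ) {x₀ : X}
    (hd : HasFDerivAt ψ (0 : X →L[ℝ] ℝ) x₀) (x : X) : ψ x₀ ≤ ψ x := by
  have hconv : ConvexOn ℝ Set.univ (ψ ∘ AffineMap.lineMap (k := ℝ) x₀ x) := by
    simpa using hψ.comp_affineMap (AffineMap.lineMap (k := ℝ) x₀ x)
  have hd' : HasDerivAt (ψ ∘ AffineMap.lineMap (k := ℝ) x₀ x) 0 0 := by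
    have hd0 : HasFDerivAt ψ (0 : X →L[ℝ] ℝ) (AffineMap.lineMap (k := ℝ) x₀ x (0 : ℝ)) := by
      simpa using hd
    simpa using hd0.comp_hasDerivAt (0 : ℝ) (AffineMap.hasDerivAt_lineMap (a := x₀) (b := x))
  have := hconv.le_slope_of_hasDerivAt (Set.mem_univ 0) (Set.mem_univ 1) one_pos hd'
  simpa [slope_def_field] using this

/-- Subgradients of `g` are nonpositive on the horizon of `g`. -/
lemma inner_nonpos_of_mem_horizon {g : Y → EReal} (hg : IsProper g) {u y : Y} {a : ℝ}
    (hu : g u = a) (hsub : ∀ (z : Y) (b : ℝ), g z = b → a + inner ℝ y (z - u) ≤ b)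
    {v : Y} (hv : v ∈ horizon g) : inner ℝ y v ≤ 0 := by
  have h := hv u (by simp [dom, hu])
  rw [hu] at h
  obtain ⟨b, hb⟩ := hg.exists_coe_eq (h.trans_lt (EReal.coe_lt_top a)).ne
  have h1 := hsub _ b hb
  rw [hb, EReal.coe_le_coe_iff] at h
  rw [add_sub_cancel_left] at h1
  linarith

/-- The saddle-point inequality at a stationary point of a fully convex composite problem. -/
lemma IsFullyConvex.exists_multiplier [CompleteSpace Y] {f : X → ℝ} {g : Y → EReal} {c : X → Y}
    (hP : IsFullyConvex f g c) {x₀ : X} (hx₀ : IsStationary f g c x₀) {a : ℝ}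
    (ha : g (c x₀) = a) :
    ∃ y₀ : Y, ∀ (x : X) (z : Y) (b : ℝ), g z = b →
      f x₀ + a ≤ f x + b + inner ℝ y₀ (c x - z) := by
  obtain ⟨-, y₀, hd, hy₀⟩ := hx₀
  have hsub := subgradient_of_mem_subdifferential_conjugate hP.g_lsc hP.g_convex ha hy₀
  refine ⟨y₀, fun x z b hz => ?_⟩
  -- The convexity defect of `c` lies in the horizon, where `⟨y₀, ·⟩ ≤ 0`.
  have hconv : ConvexOn ℝ Set.univ fun x => inner ℝ y₀ (c x) := by
    refine ⟨convex_univ, fun p _ q _ s t hs ht hst => ?_⟩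
    obtain rfl : t = 1 - s := by linarith
    have := inner_nonpos_of_mem_horizon hP.g_proper ha hsub
      (hP.c_convex p q s ⟨hs, by linarith⟩)
    rw [inner_sub_right, inner_sub_right, real_inner_smul_right, real_inner_smul_right] at this
    simp only [smul_eq_mul]
    linarith
  have h1 := le_of_convexOn_of_hasFDerivAt_zero (hP.f_convex.add hconv) hd x
  have h2 := hsub z b hz
  simp only [Pi.add_apply] at h1
  rw [inner_sub_right] at h2 ⊢
  linarith

/-- The infimum in the augmented Lagrangian is finite and attained at the proximal point. -/
lemma le_augLagrangian_of_isProx {X : Type*} {f : X → ℝ} {g : Y → EReal} {c : X → Y} (hg : IsProper g)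
    {m : ℝ} (hm : 0 < m) {x : X} {z w : Y} (hz : IsProx g m (c x + m • w) z) :
    ∃ b : ℝ, g z = b ∧
      ((f x + (b + (inner ℝ w (c x - z) + 1 / (2 * m) * ‖c x - z‖ ^ 2)) : ℝ) : EReal) ≤
        augLagrangian f g c m x w := by
  have hle : ∀ u : Y, g z + ((1 / (2 * m) * ‖z - (c x + m • w)‖ ^ 2 : ℝ) : EReal) ≤
      g u + ((1 / (2 * m) * ‖u - (c x + m • w)‖ ^ 2 : ℝ) : EReal) := fun u =>
    hz.le.trans (iInf_le _ u)
  -- Completing the square: the two penalties differ by a constant independent of `u`.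
  have hsq : ∀ u : Y, 1 / (2 * m) * ‖u - (c x + m • w)‖ ^ 2 =
      inner ℝ w (c x - u) + 1 / (2 * m) * ‖c x - u‖ ^ 2 + m / 2 * ‖w‖ ^ 2 := by
    intro u
    have : u - (c x + m • w) = -((c x - u) + m • w) := by abel
    rw [this, norm_neg, norm_add_sq_real, real_inner_smul_right, norm_smul, Real.norm_eq_abs,
      abs_of_pos hm, real_inner_comm]
    field_simp
    ring
  obtain ⟨b, hb⟩ : ∃ b : ℝ, g z = b := by
    refine hg.exists_coe_eq fun htop => ?_
    obtain ⟨u, hu⟩ := hg.1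
    obtain ⟨a, ha⟩ := hg.exists_coe_eq (z := u) (ne_of_lt hu)
    have := hle u
    rw [htop, ha, EReal.top_add_coe, ← EReal.coe_add, top_le_iff] at this
    exact EReal.coe_ne_top _ this
  refine ⟨b, hb, ?_⟩
  rw [augLagrangian, EReal.coe_add]
  refine add_le_add le_rfl (le_iInf fun u => ?_)
  by_cases hu : g u = ⊤
  · rw [hu, EReal.top_add_coe]
    exact le_top
  · obtain ⟨a, ha⟩ := hg.exists_coe_eq hu
    have := hle u
    rw [hb, ha, hsq, hsq, ← EReal.coe_add, ← EReal.coe_add, EReal.coe_le_coe_iff] at this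
    rw [ha, ← EReal.coe_add, EReal.coe_le_coe_iff]
    linarith

/-- Taking `z = c x₀` makes the multiplier and penalty terms vanish. -/
lemma iInf_augLagrangian_le {X : Type*} {f : X → ℝ} {g : Y → EReal} {c : X → Y} (m : ℝ) (x₀ : X) (w : Y)
    {a : ℝ} (ha : g (c x₀) = a) :
    (⨅ x' : X, augLagrangian f g c m x' w) ≤ ((f x₀ + a : ℝ) : EReal) := by
  refine (iInf_le _ x₀).trans ?_
  rw [augLagrangian, EReal.coe_add]
  refine add_le_add le_rfl ((iInf_le _ (c x₀)).trans ?_)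
  simp [ha]

end ExtendedReal

/-! ### Real sequences: residual against penalty parameter -/

section Penalty

/-- If the residual is bounded by a multiple of the penalty parameter, then the adaptive penalty
update drives it to zero. -/
lemma tendsto_residual_of_adaptive_update {ρ μ : ℕ → ℝ} {C θ β : ℝ} (hρ : ∀ k, 0 ≤ ρ k)
    (hμ : ∀ k, 0 < μ k) (hC : ∀ k, ρ k ≤ C * μ k) (hθ : θ ∈ Set.Ioo (0 : ℝ) 1)
    (hβ : β ∈ Set.Ioo (0 : ℝ) 1)
    (hup : ∀ k, μ (k + 1) = if k = 0 ∨ ρ k ≤ θ * ρ (k - 1) then μ k else β * μ k) :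
    Tendsto ρ atTop (𝓝 0) := by
  by_cases hev : ∀ᶠ k in atTop, k = 0 ∨ ρ k ≤ θ * ρ (k - 1)
  · obtain ⟨N, hN⟩ := eventually_atTop.1 hev
    have hbound : ∀ j, ρ (j + N) ≤ θ ^ j * ρ N := by
      intro j
      induction j with
      | zero => simp
      | succ j ih =>
        have h := (hN (j + 1 + N) (by omega)).resolve_left (by omega)
        rw [show j + 1 + N - 1 = j + N by omega] at h
        calc ρ (j + 1 + N) ≤ θ * ρ (j + N) := h
          _ ≤ θ * (θ ^ j * ρ N) := mul_le_mul_of_nonneg_left ih hθ.1.le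
          _ = θ ^ (j + 1) * ρ N := by ring
    rw [← tendsto_add_atTop_iff_nat N]
    refine squeeze_zero (fun j => hρ _) hbound ?_
    simpa using (tendsto_pow_atTop_nhds_zero_of_lt_one hθ.1.le hθ.2).mul_const (ρ N)
  · have hanti : Antitone μ := antitone_nat_of_succ_le fun k => by
      rw [hup]
      split_ifs
      · exact le_rfl
      · nlinarith [hμ k, hβ.2]
    have hlim : Tendsto μ atTop (𝓝 (⨅ k, μ k)) :=
      tendsto_atTop_ciInf hanti ⟨0, by rintro _ ⟨k, rfl⟩; exact (hμ k).le⟩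
    have hlim' : Tendsto (fun k => μ (k + 1) - β * μ k) atTop
        (𝓝 ((⨅ k, μ k) - β * ⨅ k, μ k)) :=
      ((tendsto_add_atTop_iff_nat 1).2 hlim).sub (hlim.const_mul β)
    -- Infinitely many reductions make the limit `l` of `μ` satisfy `l = β * l`, so `l = 0`.
    have hfreq : ∃ᶠ k in atTop, μ (k + 1) - β * μ k ∈ ({0} : Set ℝ) := by
      refine (not_eventually.1 hev).mono fun k hk => ?_
      rw [Set.mem_singleton_iff, hup, if_neg hk, sub_self]
    have hzero : (⨅ k, μ k) - β * ⨅ k, μ k = 0 :=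
      isClosed_singleton.mem_of_frequently_of_tendsto hfreq hlim'
    have hinf : (⨅ k, μ k) = 0 := by
      have : (1 - β) * ⨅ k, μ k = 0 := by linarith
      exact (mul_eq_zero.1 this).resolve_left (by linarith [hβ.2])
    rw [hinf] at hlim
    refine squeeze_zero hρ hC ?_
    simpa using hlim.const_mul C

/-- A quadratic inequality bounds the residual by a multiple of the penalty parameter. -/
lemma residual_le_mul {r m e M S : ℝ} (hm : 0 < m) (hM : 0 ≤ M) (hS : 0 ≤ S)
    (heS : e ≤ S ^ 2 * m) (h : 1 / (2 * m) * r ^ 2 ≤ e + M * r) :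
    r ≤ (2 * M + 2 * S) * m := by
  have h1 : r ^ 2 ≤ 2 * m * (e + M * r) := by
    have := mul_le_mul_of_nonneg_left h (by positivity : (0 : ℝ) ≤ 2 * m)
    rwa [show 2 * m * (1 / (2 * m) * r ^ 2) = r ^ 2 by field_simp] at this
  by_contra! hlt
  have hSm : 0 ≤ S * m := by positivity
  have hMm : 0 ≤ M * m := by positivity
  have h2 : r * (r - 2 * (M * m)) ≤ 2 * (S * m) ^ 2 := by nlinarith
  have h3 : r - 2 * (M * m) > 2 * (S * m) := by linarith
  have h4 : r > 2 * (S * m) := by linarith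
  -- Both factors exceed `2 S m`, so their product exceeds `4 (S m)²`, against the bound `2 (S m)²`.
  have h5 : (2 * (S * m)) * (2 * (S * m)) < r * (r - 2 * (M * m)) :=
    mul_lt_mul'' h4 h3 (by positivity) (by positivity)
  nlinarith [sq_nonneg (S * m)]

end Penalty

/-! ### Convergence of the method -/

lemma IsSafeguardedALM.penalty_pos {X Y : Type*} [NormedAddCommGroup X] [InnerProductSpace ℝ X]
    [NormedAddCommGroup Y] [InnerProductSpace ℝ Y] {f : X → ℝ} {g : Y → EReal} {c : X → Y}
    {Ysg : Set Y} {β : ℝ} {ε μ : ℕ → ℝ} {x : ℕ → X} {z y yhat : ℕ → Y}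
    (h : IsSafeguardedALM f g c Ysg β ε μ x z y yhat) (k : ℕ) : 0 < μ k := by
  induction k with
  | zero => exact h.μ_zero_pos
  | succ k ih =>
    obtain ⟨b, hb, hk⟩ := h.μ_succ k
    rw [hk]
    rcases hb with hb | rfl
    · exact mul_pos hb.1 ih
    · simpa using ih

lemma IsSafeguardedALM.penalty_le {X Y : Type*} [NormedAddCommGroup X] [InnerProductSpace ℝ X]
    [NormedAddCommGroup Y] [InnerProductSpace ℝ Y] {f : X → ℝ} {g : Y → EReal} {c : X → Y}
    {Ysg : Set Y} {β : ℝ} {ε μ : ℕ → ℝ} {x : ℕ → X} {z y yhat : ℕ → Y}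
    (h : IsSafeguardedALM f g c Ysg β ε μ x z y yhat) (k : ℕ) : μ k ≤ μ 0 := by
  refine antitone_nat_of_succ_le (fun k => ?_) (Nat.zero_le k)
  obtain ⟨b, hb, hk⟩ := h.μ_succ k
  have hb1 : b ≤ 1 := by
    rcases hb with hb | rfl
    · exact hb.2.trans h.β_mem.2.le
    · exact le_rfl
  rw [hk]
  exact mul_le_of_le_one_left (h.penalty_pos k).le hb1

/-- The safeguarded augmented Lagrangian iterates become feasible and their values converge to
the optimal value. -/
lemma IsSafeguardedALM.exists_tendsto {X Y : Type*} [NormedAddCommGroup X] [InnerProductSpace ℝ X]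
    [NormedAddCommGroup Y] [InnerProductSpace ℝ Y] [CompleteSpace Y]
    {f : X → ℝ} {g : Y → EReal} {c : X → Y} {Ysg : Set Y} {β : ℝ} {ε μ : ℕ → ℝ} {x : ℕ → X}
    {z y yhat : ℕ → Y} (hP : IsFullyConvex f g c) {x₀ : X} {a : ℝ} (ha : g (c x₀) = a)
    (hx₀ : IsStationary f g c x₀) (halg : IsSafeguardedALM f g c Ysg β ε μ x z y yhat)
    (hsum : Summable fun k => Real.sqrt (ε k / μ k)) {β' θ : ℝ} (hβ' : β' ∈ Set.Ioo (0 : ℝ) 1)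
    (hθ : θ ∈ Set.Ioo (0 : ℝ) 1) (hpen : AdaptivePenaltyUpdate c β' θ μ x z) :
    Tendsto (fun k => c (x k) - z k) atTop (𝓝 0) ∧
    ∃ G : ℕ → ℝ, (∀ k, g (z k) = G k) ∧
      Tendsto (fun k => f (x k) + G k) atTop (𝓝 (f x₀ + a)) := by
  obtain ⟨y₀, hy₀⟩ := hP.exists_multiplier hx₀ ha
  have hμ := halg.penalty_pos
  choose G hG hlow using fun k =>
    le_augLagrangian_of_isProx (f := f) hP.g_proper (hμ k) (halg.z_eq k)
  set r : ℕ → Y := fun k => c (x k) - z k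
  have hupper : ∀ k, f (x k) + (G k + (inner ℝ (yhat k) (r k) + 1 / (2 * μ k) * ‖r k‖ ^ 2)) ≤
      f x₀ + a + ε k := by
    intro k
    have := (hlow k).trans ((halg.x_approx k).trans
      (add_le_add (iInf_augLagrangian_le (f := f) (μ k) x₀ (yhat k) ha) le_rfl))
    rwa [← EReal.coe_add, EReal.coe_le_coe_iff] at this
  have hlower : ∀ k, f x₀ + a ≤ f (x k) + G k + inner ℝ y₀ (r k) := fun k =>
    hy₀ (x k) (z k) (G k) (hG k)
  obtain ⟨R, hR⟩ := halg.safeguard_compact.isBounded.exists_norm_le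
  have hyhat : ∀ k, ‖yhat k‖ ≤ R := fun k => hR _ (halg.yhat_eq k).1
  have hR0 : 0 ≤ R := (norm_nonneg _).trans (hyhat 0)
  have hinner : ∀ (w : Y) k, |inner ℝ w (r k)| ≤ ‖w‖ * ‖r k‖ := fun w k =>
    abs_real_inner_le_norm w (r k)
  have hinner' : ∀ k, |inner ℝ (yhat k) (r k)| ≤ R * ‖r k‖ := fun k =>
    (hinner _ k).trans (mul_le_mul_of_nonneg_right (hyhat k) (norm_nonneg _))
  set σ : ℕ → ℝ := fun k => Real.sqrt (ε k / μ k) with hσ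
  have hσ0 : ∀ k, 0 ≤ σ k := fun k => Real.sqrt_nonneg _
  have hσlim : Tendsto σ atTop (𝓝 0) := hsum.tendsto_atTop_zero
  have hεσ : ∀ k, ε k = σ k ^ 2 * μ k := fun k => by
    rw [hσ]
    simp only
    rw [Real.sq_sqrt (div_nonneg (halg.ε_nonneg k) (hμ k).le), div_mul_cancel₀ _ (hμ k).ne']
  obtain ⟨S, hS⟩ := hσlim.bddAbove_range
  have hσS : ∀ k, σ k ≤ S := fun k => hS ⟨k, rfl⟩
  have hS0 : 0 ≤ S := (hσ0 0).trans (hσS 0)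
  have hbound : ∀ k, ‖r k‖ ≤ (2 * (R + ‖y₀‖) + 2 * S) * μ k := by
    intro k
    refine residual_le_mul (hμ k) (by positivity) hS0 (e := ε k) ?_ ?_
    · rw [hεσ k]
      exact mul_le_mul_of_nonneg_right (pow_le_pow_left₀ (hσ0 k) (hσS k) 2) (hμ k).le
    · have h1 := (abs_le.1 (hinner' k)).1
      have h2 := (abs_le.1 (hinner y₀ k)).2
      linarith [hupper k, hlower k]
  have hnorm : Tendsto (fun k => ‖r k‖) atTop (𝓝 0) :=
    tendsto_residual_of_adaptive_update (fun k => norm_nonneg _) hμ hbound hθ hβ' hpen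
  have hεlim : Tendsto ε atTop (𝓝 0) := by
    refine squeeze_zero halg.ε_nonneg (fun k => ?_ : ∀ k, ε k ≤ σ k ^ 2 * μ 0) ?_
    · rw [hεσ k]
      exact mul_le_mul_of_nonneg_left (halg.penalty_le k) (sq_nonneg _)
    · simpa using (hσlim.pow 2).mul_const (μ 0)
  refine ⟨tendsto_zero_iff_norm_tendsto_zero.2 hnorm, G, hG, ?_⟩
  have hlo : Tendsto (fun k => f x₀ + a - ‖y₀‖ * ‖r k‖) atTop (𝓝 (f x₀ + a)) := by
    simpa using (hnorm.const_mul ‖y₀‖).const_sub (f x₀ + a)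
  have hhi : Tendsto (fun k => f x₀ + a + ε k + R * ‖r k‖) atTop (𝓝 (f x₀ + a)) := by
    simpa using (hεlim.const_add (f x₀ + a)).add (hnorm.const_mul R)
  refine tendsto_of_tendsto_of_tendsto_of_le_of_le hlo hhi (fun k => ?_) (fun k => ?_)
  · have := (abs_le.1 (hinner y₀ k)).2
    simp only
    linarith [hlower k]
  · have h1 := (abs_le.1 (hinner' k)).1
    have h2 : 0 ≤ 1 / (2 * μ k) * ‖r k‖ ^ 2 :=
      mul_nonneg (by have := hμ k; positivity) (sq_nonneg _)
    simp only
    linarith [hupper k]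

end ConvexComposite

theorem corollary5p7
    {X Y : Type*}
    [NormedAddCommGroup X] [InnerProductSpace ℝ X] [FiniteDimensional ℝ X]
    [NormedAddCommGroup Y] [InnerProductSpace ℝ Y] [FiniteDimensional ℝ Y]
    (f : X → ℝ) (g : Y → EReal) (c : X → Y)
    (hP : ConvexComposite.IsFullyConvex f g c)
    (hstat : ∃ x₀, ConvexComposite.IsMinimizer f g c x₀ ∧ ConvexComposite.IsStationary f g c x₀)
    (Ysg : Set Y) (β : ℝ) (ε μ : ℕ → ℝ) (x : ℕ → X) (z y yhat : ℕ → Y)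
    (halg : ConvexComposite.IsSafeguardedALM f g c Ysg β ε μ x z y yhat)
    (hsum : Summable fun k => Real.sqrt (ε k / μ k))
    (hpen : ∃ β' ∈ Set.Ioo (0 : ℝ) 1, ∃ θ ∈ Set.Ioo (0 : ℝ) 1,
      ConvexComposite.AdaptivePenaltyUpdate c β' θ μ x z) :
    Tendsto (fun k => c (x k) - z k) atTop (𝓝 0) ∧
    limsup (fun k => (f (x k) : EReal) + g (z k)) atTop ≤ ConvexComposite.optimalValue f g c ∧
    (∀ xbar : X, MapClusterPt xbar atTop x → ConvexComposite.IsMinimizer f g c xbar) ∧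
    (∀ (xbar : X) (κ : ℕ → ℕ), StrictMono κ → Tendsto (fun j => x (κ j)) atTop (𝓝 xbar) →
      Tendsto (fun j => z (κ j)) atTop (𝓝 (c xbar)) ∧
      Tendsto (fun j => (f (x (κ j)) : EReal) + g (z (κ j))) atTop
        (𝓝 (ConvexComposite.optimalValue f g c))) := by
  obtain ⟨x₀, hmin, hst⟩ := hstat
  obtain ⟨β', hβ', θ, hθ, hupd⟩ := hpen
  obtain ⟨a, ha⟩ := hP.g_proper.exists_coe_eq (z := c x₀) (ne_of_lt hmin.1)
  obtain ⟨hr, G, hG, hlim⟩ := halg.exists_tendsto hP ha hst hsum hβ' hθ hupd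
  have hopt : ConvexComposite.optimalValue f g c = ((f x₀ + a : ℝ) : EReal) := by
    have hobj : ConvexComposite.objective f g c x₀ = ((f x₀ + a : ℝ) : EReal) := by
      rw [ConvexComposite.objective, ha, EReal.coe_add]
    rw [← hobj]
    exact le_antisymm (iInf_le _ x₀) (le_iInf hmin.2)
  have hval : Tendsto (fun k => (f (x k) : EReal) + g (z k)) atTop
      (𝓝 (ConvexComposite.optimalValue f g c)) := by
    rw [hopt]
    simp only [hG, ← EReal.coe_add]
    exact (continuous_coe_real_ereal.tendsto _).comp hlim
  have hz : ∀ (xbar : X) (κ : ℕ → ℕ), StrictMono κ →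
      Tendsto (fun j => x (κ j)) atTop (𝓝 xbar) →
      Tendsto (fun j => z (κ j)) atTop (𝓝 (c xbar)) := by
    intro xbar κ hκ hx
    have h1 := (hP.c_contDiff.continuous.tendsto xbar).comp hx
    simpa [Function.comp_def] using h1.sub (hr.comp hκ.tendsto_atTop)
  refine ⟨hr, hval.limsup_eq.le, fun xbar hx => ?_, fun xbar κ hκ hx =>
    ⟨hz xbar κ hκ hx, hval.comp hκ.tendsto_atTop⟩⟩
  obtain ⟨κ, hκ, hκx⟩ := hx.tendsto_subseq
  have hzκ := hz xbar κ hκ hκx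
  have hGκ : Tendsto (fun j => G (κ j)) atTop (𝓝 (f x₀ + a - f xbar)) := by
    have h1 := (hP.f_contDiff.continuous.tendsto xbar).comp hκx
    simpa [Function.comp_def] using (hlim.comp hκ.tendsto_atTop).sub h1
  -- The points `(z (κ j), G (κ j))` of the closed epigraph converge, so their limit gives `Φ xbar ≤
  -- Φ*`.
  have hle : g (c xbar) ≤ ((f x₀ + a - f xbar : ℝ) : EReal) :=
    (ConvexComposite.isClosed_epigraph_real hP.g_lsc).mem_of_tendsto (hzκ.prodMk_nhds hGκ)
      (Eventually.of_forall fun j => (hG (κ j)).le)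
  refine ⟨hle.trans_lt (EReal.coe_lt_top _), fun x' => ?_⟩
  have hbar : ConvexComposite.objective f g c xbar ≤ ConvexComposite.optimalValue f g c := by
    obtain ⟨b, hb⟩ :=
      hP.g_proper.exists_coe_eq (z := c xbar) (hle.trans_lt (EReal.coe_lt_top _)).ne
    rw [hb, EReal.coe_le_coe_iff] at hle
    rw [ConvexComposite.objective, hopt, hb, ← EReal.coe_add, EReal.coe_le_coe_iff]
    linarith
  exact hbar.trans (iInf_le _ x')
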